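/- Let $H$ be a complex Hilbert space (not necessarily separable) and let $M \subseteq B(H)$ be a von Neumann algebra with identity $I$. For $A \in M$ let $R(A)$ denote the range projection of $A$, i.e. the orthogonal projection of $H$ onto the closure of the range of $A$. Assume that $M$ has no direct summand of type $\mathrm{I}_1$, i.e. there is no nonzero central projection $Z$ in $M$ such that $MZ$ is abelian. Let $\Phi \colon M \to M$ be a map (not assumed to be linear or continuous) which is - ortho-additive: $\Phi(A+B) = \Phi(A) + \Phi(B)$ for all $A, B \in M$ with $A^*B = 0$; and - range-contractive: $R(\Phi(A)) \leq R(A)$ for all $A \in M$. Then $\Phi(A) = A\,\Phi(I)$ for every $A \in M$. -/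

import Mathlib

namespace VonNeumannAlgebra

variable {H : Type*} [NormedAddCommGroup H] [InnerProductSpace ℂ H] [CompleteSpace H]

/-- The range projection of a bounded operator `A`: the orthogonal projection of `H` onto the
closure of the range of `A`. -/
noncomputable def rangeProjection (A : H →L[ℂ] H) : H →L[ℂ] H :=
  A.range.topologicalClosure.starProjection

/-- Two operators `A`, `B` in `M` are orthogonal if `A* B = 0`. -/
def Orthogonal (M : VonNeumannAlgebra H) (A B : M) : Prop :=
  star A * B = 0

/-- `Φ` is ortho-additive if `Φ (A + B) = Φ A + Φ B` for all orthogonal `A`, `B` in `M`. -/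
def IsOrthoAdditive (M : VonNeumannAlgebra H) (Φ : M → M) : Prop :=
  ∀ A B : M, Orthogonal M A B → Φ (A + B) = Φ A + Φ B

/-- `Φ` is range-contractive if the range projection of `Φ A` is dominated by that of `A`. -/
def IsRangeContractive (M : VonNeumannAlgebra H) (Φ : M → M) : Prop :=
  ∀ A : M, rangeProjection (Φ A : H →L[ℂ] H) ≤ rangeProjection (A : H →L[ℂ] H)

/-- A projection `P` in `M` is abelian if `P M P` is abelian. -/
def IsAbelianProjection (M : VonNeumannAlgebra H) (P : M) : Prop :=
  IsStarProjection P ∧ ∀ A B : M, Commute (P * A * P) (P * B * P)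

/-- `M` has a direct summand of type `I₁`: there is a nonzero central projection `Z` in `M` such
that the direct summand `M Z = Z M Z` is of type `I₁`, i.e. such that its identity `Z` is an
abelian projection. -/
def HasTypeIOneSummand (M : VonNeumannAlgebra H) : Prop :=
  ∃ Z : M, Z ≠ 0 ∧ Z ∈ Set.center M ∧ IsAbelianProjection M Z

end VonNeumannAlgebra

/-! The C with Φ(CX) = CΦ(X) for all X form a multiplicative monoid. Ortho-additivity and
range-contractivity serve only to put every projection in it
(`IsOrthoAdditive.mem_leftHomogenizer`). For a partial isometry V with V² = 0 and P = V*V, the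
projection onto the graph of V produces P/2, hence 2P and V, and makes Φ additive on PM; the monoid
then contains all of PM (`mul_mem_leftHomogenizer`). Evaluating at 1 gives V(Φ(X) - XΦ(1)) = 0.

The projection onto the common kernel of all such V is central, and its summand has no nonzero
element of square zero. That summand is therefore abelian, hence zero
(`IsBaerStarRing.eq_zero_of_forall_mul_eq_zero`), and Φ(X) = XΦ(1). -/

/-- An element `V` with `V V* V = V` and `V² = 0`: a partial isometry whose initial and final
projections are orthogonal. -/
structure IsSquareZeroPartialIsometry {A : Type*} [Ring A] [StarRing A] (V : A) : Prop where
  mul_star_mul : V * (star V * V) = V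
  mul_self : V * V = 0

namespace IsSquareZeroPartialIsometry

section Ring

variable {A : Type*} [Ring A] [StarRing A] {V : A}

protected theorem star (hV : IsSquareZeroPartialIsometry V) :
    IsSquareZeroPartialIsometry (star V) where
  mul_star_mul := by
    simpa [mul_assoc] using congr(star $(hV.mul_star_mul))
  mul_self := by simpa using congr(star $(hV.mul_self))

theorem mul_star_mul_assoc (hV : IsSquareZeroPartialIsometry V) (X : A) :
    V * (star V * (V * X)) = V * X := by
  rw [← mul_assoc (star V), ← mul_assoc V, hV.mul_star_mul]

theorem mul_self_assoc (hV : IsSquareZeroPartialIsometry V) (X : A) : V * (V * X) = 0 := by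
  rw [← mul_assoc, hV.mul_self, zero_mul]

theorem star_mul_mul_star (hV : IsSquareZeroPartialIsometry V) :
    star V * (V * star V) = star V := by
  simpa using hV.star.mul_star_mul

theorem star_mul_mul_star_assoc (hV : IsSquareZeroPartialIsometry V) (X : A) :
    star V * (V * (star V * X)) = star V * X := by
  simpa using hV.star.mul_star_mul_assoc X

theorem isStarProjection_star_mul_self (hV : IsSquareZeroPartialIsometry V) :
    IsStarProjection (star V * V) where
  isIdempotentElem := by simp [IsIdempotentElem, mul_assoc, hV.mul_star_mul]
  isSelfAdjoint := .star_mul_self V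

theorem isStarProjection_mul_star_self (hV : IsSquareZeroPartialIsometry V) :
    IsStarProjection (V * star V) := by
  simpa using hV.star.isStarProjection_star_mul_self

/-- The projection onto the graph of `V` restricted to its initial space. -/
theorem isStarProjection_graph [Module ℝ A] [IsScalarTower ℝ A A] [SMulCommClass ℝ A A]
    [StarModule ℝ A] (hV : IsSquareZeroPartialIsometry V) :
    IsStarProjection ((2⁻¹ : ℝ) • (star V * V + V * star V + V + star V)) where
  isIdempotentElem := by
    simp only [IsIdempotentElem, smul_mul_assoc, mul_smul_comm, mul_add, add_mul, mul_assoc,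
      hV.mul_star_mul, hV.mul_self, hV.mul_self_assoc,
      hV.star_mul_mul_star, hV.star.mul_self, hV.star.mul_self_assoc,
      mul_zero]
    module
  isSelfAdjoint := by
    simp only [IsSelfAdjoint, star_smul, star_add, star_mul, star_star, star_trivial]
    module

theorem mul_unitary (hV : IsSquareZeroPartialIsometry V) {u : A} (hu : u ∈ unitary A)
    (hc : Commute (star V * V) u) : IsSquareZeroPartialIsometry (V * u) where
  mul_star_mul := by
    have h : u * star u = 1 := Unitary.mul_star_self_of_mem hu
    calc V * u * (star (V * u) * (V * u)) = V * (u * star u) * star V * V * u := by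
          simp only [star_mul, mul_assoc]
      _ = V * (star V * V) * u := by simp only [h, mul_one, mul_assoc]
      _ = V * u := by rw [hV.mul_star_mul]
  mul_self := by
    calc V * u * (V * u) = V * (star V * V * u) * (V * u) := by
          rw [mul_assoc (star V), hV.mul_star_mul_assoc]
      _ = 0 := by
          rw [hc.eq]
          simp only [mul_assoc, hV.mul_self_assoc, mul_zero]

theorem unitary_conj (hV : IsSquareZeroPartialIsometry V) {u : A} (hu : u ∈ unitary A) :
    IsSquareZeroPartialIsometry (star u * V * u) where
  mul_star_mul := by
    have h (X : A) : u * (star u * X) = X := by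
      rw [← mul_assoc, Unitary.mul_star_self_of_mem hu, one_mul]
    simp only [star_mul, star_star, mul_assoc, h, hV.mul_star_mul_assoc]
  mul_self := by
    have h (X : A) : u * (star u * X) = X := by
      rw [← mul_assoc, Unitary.mul_star_self_of_mem hu, one_mul]
    simp only [mul_assoc, h, hV.mul_self_assoc, mul_zero]

end Ring

end IsSquareZeroPartialIsometry

/-! ### The monoid generated from projections -/

/-- The elements `C` for which `Φ` commutes with left multiplication by `C`. -/
def leftHomogenizer {A : Type*} [Monoid A] (Φ : A → A) : Submonoid A where
  carrier := {C | ∀ X, Φ (C * X) = C * Φ X}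
  one_mem' X := by simp
  mul_mem' hC hD X := by rw [mul_assoc, hC, hD, mul_assoc]

namespace IsSquareZeroPartialIsometry

variable {A : Type*} [CStarAlgebra A] {Φ : A → A} {V : A}

theorem half_smul_mem (hΦ : ∀ P, IsStarProjection P → P ∈ leftHomogenizer Φ)
    (hV : IsSquareZeroPartialIsometry V) :
    (2⁻¹ : ℝ) • (star V * V) ∈ leftHomogenizer Φ := by
  have hP := hΦ _ hV.isStarProjection_star_mul_self
  have h := mul_mem (mul_mem hP (hΦ _ hV.isStarProjection_graph)) hP
  convert h using 1
  simp only [smul_mul_assoc, mul_smul_comm, mul_add, add_mul, mul_assoc,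
      hV.mul_star_mul, hV.mul_self, hV.mul_self_assoc,
      hV.star_mul_mul_star, hV.star.mul_self_assoc, mul_zero, zero_mul]
  module

/-- Products of projections are contractions, so 2P is reached by inverting P/2 on the elements
fixed by P. -/
theorem two_smul_mem (hΦ : ∀ P, IsStarProjection P → P ∈ leftHomogenizer Φ)
    (hV : IsSquareZeroPartialIsometry V) :
    (2 : ℝ) • (star V * V) ∈ leftHomogenizer Φ := by
  intro X
  have hP := hV.isStarProjection_star_mul_self
  have h1 := hV.half_smul_mem hΦ ((2 : ℝ) • (star V * V) * X)
  have h2 := hΦ _ hP ((2 : ℝ) • (star V * V) * X)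
  have h3 : star V * V * ((2 : ℝ) • (star V * V) * X) = (2 : ℝ) • (star V * V) * X := by
    rw [← mul_assoc, mul_smul_comm, hP.isIdempotentElem.eq]
  have h4 : (2⁻¹ : ℝ) • (star V * V) * ((2 : ℝ) • (star V * V) * X) = star V * V * X := by
    rw [← mul_assoc, smul_mul_smul_comm, hP.isIdempotentElem.eq]
    norm_num
  rw [h4, hΦ _ hP, smul_mul_assoc (2⁻¹ : ℝ), ← h2, h3] at h1
  rw [smul_mul_assoc (2 : ℝ) _ (Φ X), h1, smul_smul]
  norm_num

theorem star_mem_leftHomogenizer (hΦ : ∀ P, IsStarProjection P → P ∈ leftHomogenizer Φ)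
    (hV : IsSquareZeroPartialIsometry V) : star V ∈ leftHomogenizer Φ := by
  have h := mul_mem (hV.two_smul_mem hΦ) (mul_mem (hΦ _ hV.isStarProjection_graph)
    (hΦ _ hV.isStarProjection_mul_star_self))
  convert h using 1
  simp only [smul_mul_assoc, mul_smul_comm, mul_add, add_mul, mul_assoc,
      hV.mul_self_assoc, hV.star_mul_mul_star, mul_zero]
  module

theorem mem_leftHomogenizer (hΦ : ∀ P, IsStarProjection P → P ∈ leftHomogenizer Φ)
    (hV : IsSquareZeroPartialIsometry V) : V ∈ leftHomogenizer Φ := by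
  simpa using hV.star.star_mem_leftHomogenizer hΦ

/-- V moves the second summand into an orthogonal corner: P + V* maps PX + VY to PX + PY, while P
and V* separately recover the two summands. -/
theorem map_mul_add (hΦ : ∀ P, IsStarProjection P → P ∈ leftHomogenizer Φ)
    (hV : IsSquareZeroPartialIsometry V) (X Y : A) :
    Φ (star V * V * X + star V * V * Y) = Φ (star V * V * X) + Φ (star V * V * Y) := by
  have hG : star V * V + star V ∈ leftHomogenizer Φ := by
    have h := mul_mem (hV.two_smul_mem hΦ) (hΦ _ hV.isStarProjection_graph)
    convert h using 1
    simp only [smul_mul_assoc, mul_smul_comm, mul_add, mul_assoc,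
      hV.mul_star_mul, hV.mul_self, hV.mul_self_assoc,
      hV.star_mul_mul_star, mul_zero]
    module
  have h1 : (star V * V + star V) * (star V * V * X + V * Y)
      = star V * V * X + star V * V * Y := by
    simp only [mul_add, add_mul, mul_assoc, hV.mul_self_assoc,
      hV.star_mul_mul_star_assoc, hV.star.mul_self_assoc, mul_zero]
    abel
  have hP := hΦ _ hV.isStarProjection_star_mul_self
  have h2 : star V * V * (star V * V * X + V * Y) = star V * V * X := by
    simp only [mul_add, mul_assoc, hV.mul_self_assoc, hV.star_mul_mul_star_assoc, mul_zero,
      add_zero]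
  have h3 : star V * (star V * V * X + V * Y) = star V * V * Y := by
    simp only [mul_add, mul_assoc, hV.star.mul_self_assoc, zero_add]
  rw [← h1, hG, add_mul, ← hP, ← hV.star_mem_leftHomogenizer hΦ, h2, h3]

theorem mul_add_mem (hΦ : ∀ P, IsStarProjection P → P ∈ leftHomogenizer Φ)
    (hV : IsSquareZeroPartialIsometry V) {C D : A}
    (hC : star V * V * C ∈ leftHomogenizer Φ) (hD : star V * V * D ∈ leftHomogenizer Φ) :
    star V * V * (C + D) ∈ leftHomogenizer Φ := by
  intro X
  rw [mul_add, add_mul, mul_assoc _ C, mul_assoc _ D, hV.map_mul_add hΦ, ← mul_assoc _ C,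
    ← mul_assoc _ D, hC, hD, add_mul]

theorem mul_nsmul_mem (hΦ : ∀ P, IsStarProjection P → P ∈ leftHomogenizer Φ)
    (hV : IsSquareZeroPartialIsometry V) {C : A}
    (hC : star V * V * C ∈ leftHomogenizer Φ) (n : ℕ) :
    star V * V * (n • C) ∈ leftHomogenizer Φ := by
  induction n with
  | zero => simpa using hΦ 0 (.zero A)
  | succ n ih =>
    rw [succ_nsmul]
    exact hV.mul_add_mem hΦ ih hC

/-- Pu factors as V*(Vu), and Vu is again a square-zero partial isometry. -/
theorem mul_unitary_mem (hΦ : ∀ P, IsStarProjection P → P ∈ leftHomogenizer Φ)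
    (hV : IsSquareZeroPartialIsometry V) {u : A} (hu : u ∈ unitary A)
    (hc : Commute (star V * V) u) : star V * V * u ∈ leftHomogenizer Φ := by
  rw [mul_assoc]
  exact mul_mem (hV.star_mem_leftHomogenizer hΦ) ((hV.mul_unitary hu hc).mem_leftHomogenizer hΦ)

theorem mul_selfAdjoint_mem (hΦ : ∀ P, IsStarProjection P → P ∈ leftHomogenizer Φ)
    (hV : IsSquareZeroPartialIsometry V) {C : A} (hC : IsSelfAdjoint C)
    (hc : Commute (star V * V) C) : star V * V * C ∈ leftHomogenizer Φ := by
  let _ := CStarAlgebra.spectralOrder A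
  let _ := CStarAlgebra.spectralOrderedRing A
  wlog h1 : ‖C‖ ≤ 1 generalizing C
  -- Rescaling is by an integer, since additivity on the corner handles integer multiples.
  · obtain ⟨n, hn⟩ := exists_nat_ge ‖C‖
    have hn0 : (0 : ℝ) < n := by linarith
    have h := this (C := (n : ℝ)⁻¹ • C) ((IsSelfAdjoint.all _).smul hC) (hc.smul_right _) (by
      rw [norm_smul, norm_inv, Real.norm_natCast]
      exact inv_mul_le_one_of_le₀ hn hn0.le)
    have h' := hV.mul_nsmul_mem hΦ h n
    rwa [← Nat.cast_smul_eq_nsmul ℝ, smul_inv_smul₀ hn0.ne'] at h'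
  -- A self-adjoint contraction is the mean of the unitaries C ± i√(1 - C²).
  have hu := hC.self_add_I_smul_cfcSqrt_sub_sq_mem_unitary C h1
  have hs : Commute (star V * V) (CFC.sqrt (1 - C ^ 2)) := by
    rw [CFC.sqrt_eq_cfc]
    exact (Commute.cfc_nnreal (((Commute.one_right _).sub_right (hc.pow_right 2))).symm _).symm
  have hcu := hc.add_right (hs.smul_right Complex.I)
  have hsu : star (C + Complex.I • CFC.sqrt (1 - C ^ 2))
      = C - Complex.I • CFC.sqrt (1 - C ^ 2) := by
    have h0 : IsSelfAdjoint (CFC.sqrt (1 - C ^ 2)) := .of_nonneg (CFC.sqrt_nonneg _)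
    rw [star_add, star_smul, hC.star_eq, h0.star_eq]
    simp [sub_eq_add_neg]
  have h := hV.mul_add_mem hΦ (hV.mul_unitary_mem hΦ hu hcu)
    (hV.mul_unitary_mem hΦ (Unitary.star_mem hu)
      (by rw [hsu]; exact hc.sub_right (hs.smul_right Complex.I)))
  convert mul_mem (hV.half_smul_mem hΦ) h using 1
  rw [hsu, smul_mul_assoc, ← mul_assoc, hV.isStarProjection_star_mul_self.isIdempotentElem.eq,
    ← mul_smul_comm]
  congr 1
  module

theorem mul_mem_of_commute (hΦ : ∀ P, IsStarProjection P → P ∈ leftHomogenizer Φ)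
    (hV : IsSquareZeroPartialIsometry V) {C : A} (hc : Commute (star V * V) C) :
    star V * V * C ∈ leftHomogenizer Φ := by
  have hc' : Commute (star V * V) (star C) := by
    have := hc.star_star
    simpa using this
  have hI : star V * V * (Complex.I • 1) ∈ leftHomogenizer Φ :=
    hV.mul_unitary_mem hΦ (by simp [Unitary.mem_iff, smul_smul]) ((Commute.one_right _).smul_right _)
  have hre : Commute (star V * V) (realPart C : A) := by
    rw [realPart_apply_coe]
    exact (hc.add_right hc').smul_right _
  have him : Commute (star V * V) (imaginaryPart C : A) := by
    rw [imaginaryPart_apply_coe]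
    exact ((hc.sub_right hc').smul_right _).smul_right _
  have h := hV.mul_add_mem hΦ (hV.mul_selfAdjoint_mem hΦ (realPart C).2 hre)
    (D := Complex.I • (imaginaryPart C : A)) (by
      convert mul_mem hI (hV.mul_selfAdjoint_mem hΦ (imaginaryPart C).2 him) using 1
      rw [mul_smul_comm Complex.I _ (1 : A), mul_one, smul_mul_assoc, ← mul_assoc (star V * V) (star V * V),
        hV.isStarProjection_star_mul_self.isIdempotentElem.eq, mul_smul_comm])
  rwa [realPart_add_I_smul_imaginaryPart] at h

theorem _root_.CStarAlgebra.isUnit_one_add_mul_star_self (X : A) : IsUnit (1 + X * star X) := by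
  let _ := CStarAlgebra.spectralOrder A
  let _ := CStarAlgebra.spectralOrderedRing A
  have h0 : 0 ≤ X * star X := mul_star_self_nonneg X
  have h : (-1 : ℝ) ∉ spectrum ℝ (X * star X) := fun h ↦ by
    have := spectrum_nonneg_of_nonneg h0 h
    linarith
  rw [spectrum.notMem_iff] at h
  convert h.neg using 1
  simp
  abel

/-- With K = (1 + XX*)⁻¹, the projection onto the graph of X* over the range of P is (P + X*)K(P +
X). Multiplying it on the left by P(1 + XX*), which commutes with P, leaves P + X; then P is
subtracted. -/
theorem mul_mem_of_mul_eq_zero (hΦ : ∀ P, IsStarProjection P → P ∈ leftHomogenizer Φ)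
    (hV : IsSquareZeroPartialIsometry V) {X : A} (hX : star V * V * X = X)
    (hX0 : X * (star V * V) = 0) : X ∈ leftHomogenizer Φ := by
  have hP := hV.isStarProjection_star_mul_self
  have hV1 : star V * V * (-1) ∈ leftHomogenizer Φ :=
    hV.mul_unitary_mem hΦ (by simp [Unitary.mem_iff]) ((Commute.one_right _).neg_right)
  have hadd := fun {C D} ↦ hV.mul_add_mem hΦ (C := C) (D := D)
  have hcomm := fun {C} ↦ hV.mul_mem_of_commute hΦ (C := C)
  generalize star V * V = P at *
  have hPP := hP.isIdempotentElem.eq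
  have hPs := hP.isSelfAdjoint.star_eq
  have hXs : star X * P = star X := by simpa [hPs] using congr(star $hX)
  have hX0s : P * star X = 0 := by simpa [hPs] using congr(star $hX0)
  obtain ⟨⟨S, K, hSK, hKS⟩, hS⟩ := CStarAlgebra.isUnit_one_add_mul_star_self X
  dsimp only at hS
  subst hS
  have hSs : star (1 + X * star X) = 1 + X * star X := by simp
  have hSP : Commute (1 + X * star X) P := by
    simp [Commute, SemiconjBy, add_mul, mul_add, mul_assoc, hXs, ← mul_assoc P, hX]
  have hKs : star K = K := by
    have : star K * (1 + X * star X) = 1 := by simpa [hSs] using congr(star $hSK)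
    exact left_inv_eq_right_inv this hSK
  have hKP : K * P = P * K := by
    calc K * P = K * (P * (1 + X * star X)) * K := by rw [mul_assoc, mul_assoc, hSK, mul_one]
      _ = P * K := by rw [← hSP.eq, ← mul_assoc, hKS, one_mul]
  have hPX : (P + X) * (P + star X) = P * (1 + X * star X) := by
    simp [add_mul, mul_add, hX0, hX0s, hPP, ← mul_assoc P, hX]
  have hPPX : P * (P + X) = P + X := by rw [mul_add, hPP, hX]
  have hG : IsStarProjection ((P + star X) * K * (P + X)) := by
    refine ⟨?_, ?_⟩
    · unfold IsIdempotentElem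
      calc (P + star X) * K * (P + X) * ((P + star X) * K * (P + X))
          = (P + star X) * K * ((P + X) * (P + star X)) * K * (P + X) := by
            simp only [mul_assoc]
        _ = (P + star X) * K * P * ((1 + X * star X) * K) * (P + X) := by
            rw [hPX]; simp only [mul_assoc]
        _ = (P + star X) * K * (P + X) := by
            rw [hSK, mul_one, mul_assoc, hPPX]
    · simp only [IsSelfAdjoint, star_mul, star_add, star_star, hPs, hKs, mul_assoc]
  have hPG : P * (P * (1 + X * star X)) * ((P + star X) * K * (P + X)) = P + X := by
    calc P * (P * (1 + X * star X)) * ((P + star X) * K * (P + X))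
        = P * (1 + X * star X) * (P + star X) * K * (P + X) := by
          rw [← mul_assoc P P, hPP]; simp only [mul_assoc]
      _ = (1 + X * star X) * (P * (P + star X)) * K * (P + X) := by
          rw [← hSP.eq]; simp only [mul_assoc]
      _ = (1 + X * star X) * (P * K) * (P + X) := by
          rw [mul_add P, hPP, hX0s, add_zero, mul_assoc _ P]
      _ = P + X := by rw [← hKP, ← mul_assoc, hSK, one_mul, hPPX]
  have hPX_mem : P * (P + X) ∈ leftHomogenizer Φ := by
    rw [hPPX, ← hPG]
    exact mul_mem (hcomm (((Commute.refl P).mul_right hSP.symm))) (hΦ _ hG)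
  have h := hadd hPX_mem (D := -P) (by simpa [hPP] using hV1)
  rwa [add_neg_cancel_comm, hX] at h

/-- Splits PX into PXP, which commutes with P, and PX(1 - P), which is off-diagonal. -/
theorem mul_mem_leftHomogenizer (hΦ : ∀ P, IsStarProjection P → P ∈ leftHomogenizer Φ)
    (hV : IsSquareZeroPartialIsometry V) (X : A) : star V * V * X ∈ leftHomogenizer Φ := by
  have hP := hV.isStarProjection_star_mul_self.isIdempotentElem.eq
  have h1 : star V * V * (X * (star V * V)) ∈ leftHomogenizer Φ := by
    have := hV.mul_mem_of_commute hΦ (C := star V * V * X * (star V * V)) (by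
      rw [Commute, SemiconjBy, mul_assoc (star V * V * X), hP, mul_assoc (star V * V) X,
        ← mul_assoc (star V * V) (star V * V), hP])
    rwa [mul_assoc (star V * V) X, ← mul_assoc (star V * V) (star V * V), hP] at this
  have h2 : star V * V * (X - X * (star V * V)) ∈ leftHomogenizer Φ :=
    hV.mul_mem_of_mul_eq_zero hΦ (by rw [← mul_assoc, hP])
      (by rw [mul_assoc, sub_mul, mul_assoc X, hP, sub_self, mul_zero])
  simpa using hV.mul_add_mem hΦ h1 h2

theorem mul_map_sub_eq_zero (hΦ : ∀ P, IsStarProjection P → P ∈ leftHomogenizer Φ)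
    (hV : IsSquareZeroPartialIsometry V) (X : A) : V * (Φ X - X * Φ 1) = 0 := by
  have h1 := hV.mul_mem_leftHomogenizer hΦ X 1
  rw [mul_one, hΦ _ hV.isStarProjection_star_mul_self] at h1
  rw [← hV.mul_star_mul, mul_assoc, mul_sub, h1, mul_assoc, sub_self, mul_zero]

end IsSquareZeroPartialIsometry

/-! ### C*-algebras whose annihilators are generated by projections -/

/-- Every right annihilator is generated by a projection. -/
def IsBaerStarRing (A : Type*) [Ring A] [StarRing A] : Prop :=
  ∀ S : Set A, ∃ Z : A, IsStarProjection Z ∧ ∀ D, (∀ V ∈ S, V * D = 0) ↔ Z * D = D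

theorem IsBaerStarRing.exists_range_projection {A : Type*} [Ring A] [StarRing A]
    (hA : IsBaerStarRing A) (D : A) :
    ∃ E : A, IsStarProjection E ∧ E * D = D ∧ ∀ C, C * D = 0 → C * E = 0 := by
  obtain ⟨F, hF, h⟩ := hA {star D}
  simp only [Set.mem_singleton_iff, forall_eq] at h
  refine ⟨1 - F, hF.one_sub, ?_, fun C hC ↦ ?_⟩
  · have h1 : D * 1 = D := mul_one D
    have h2 : star D * F = 0 := (h F).2 hF.isIdempotentElem.eq
    have h3 : F * D = 0 := by simpa [hF.isSelfAdjoint.star_eq] using congr(star $h2)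
    rw [sub_mul, one_mul, h3, sub_zero]
  · have h2 : F * star C = star C := (h _).1 (by simpa using congr(star $hC))
    have h3 : C * F = C := by simpa [hF.isSelfAdjoint.star_eq] using congr(star $h2)
    rw [mul_sub, mul_one, h3, sub_self]

section

variable {A : Type*} [CStarAlgebra A]

/-- A nonzero element of square zero yields, by polar decomposition and a spectral cut-off,
a nonzero square-zero partial isometry. -/
theorem IsBaerStarRing.exists_isSquareZeroPartialIsometry (hA : IsBaerStarRing A) {X : A}
    (hX : X ≠ 0) (hXX : X * X = 0) :
    ∃ W, X * W ≠ 0 ∧ IsSquareZeroPartialIsometry (X * W) := by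
  let _ := CStarAlgebra.spectralOrder A
  let _ := CStarAlgebra.spectralOrderedRing A
  have : Nontrivial A := ⟨X, 0, hX⟩
  set T := star X * X with hT
  have hT0 : 0 ≤ T := star_mul_self_nonneg X
  have hTsa : IsSelfAdjoint T := .star_mul_self X
  have hTn : 0 < ‖T‖ := by
    rw [hT, CStarRing.norm_star_mul_self]
    have := norm_pos_iff.2 hX
    positivity
  set ε := ‖T‖ / 2 with hε
  have hε0 : 0 < ε := by positivity
  have hm (t : ℝ) : 0 < max t ε := lt_max_of_lt_right hε0
  have hgc : Continuous fun t : ℝ ↦ max (t - ε) 0 := by fun_prop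
  have hhc : Continuous fun t : ℝ ↦ max (t - ε) 0 / max t ε :=
    hgc.div (by fun_prop) fun t ↦ (hm t).ne'
  have hfc : Continuous fun t : ℝ ↦ (√(max t ε))⁻¹ :=
    Continuous.inv₀ (by fun_prop) fun t ↦ (Real.sqrt_pos.2 (hm t)).ne'
  set G := cfc (fun t : ℝ ↦ max (t - ε) 0) T with hG
  -- F is T^(-1/2) on the spectrum above ε, where G lives.
  set F := cfc (fun t : ℝ ↦ (√(max t ε))⁻¹) T with hF
  have hFs : star F = F := (cfc_predicate _ T : IsSelfAdjoint F).star_eq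
  have hGs : star G = G := (cfc_predicate _ T : IsSelfAdjoint G).star_eq
  have hG0 : G ≠ 0 := fun h ↦ by
    have h' : cfc (fun t : ℝ ↦ max (t - ε) 0) T = cfc (fun _ : ℝ ↦ 0) T := by
      rw [cfc_const_zero, ← hG, h]
    have h1 := eqOn_of_cfc_eq_cfc h' hgc.continuousOn continuousOn_const hTsa (CStarAlgebra.norm_mem_spectrum_of_nonneg hT0)
    have h2 := le_max_left (‖T‖ - ε) 0
    dsimp only at h1
    linarith
  -- G is a multiple of T, and TX = X*XX = 0.
  have hGX : G * X = 0 := by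
    have h1 : G = cfc (fun t : ℝ ↦ max (t - ε) 0 / max t ε) T * T := by
      have h2 := cfc_mul (fun t : ℝ ↦ max (t - ε) 0 / max t ε) (fun t ↦ t) T
        hhc.continuousOn continuousOn_id
      rw [cfc_id' ℝ T] at h2
      rw [← h2, hG]
      congr 1
      ext t
      rcases le_total t ε with h | h
      · simp [h]
      · rw [max_eq_left h, div_mul_cancel₀ _ (hε0.trans_le h).ne']
    rw [h1, mul_assoc, hT, mul_assoc, hXX, mul_zero, mul_zero]
  have hFTF : (F * T * F - 1) * G = 0 := by
    have h1 : F * T = cfc (fun t : ℝ ↦ (√(max t ε))⁻¹ * t) T := by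
      rw [cfc_mul _ (fun t ↦ t) T hfc.continuousOn continuousOn_id, cfc_id' ℝ T]
    have hfc' : Continuous fun t : ℝ ↦ (√(max t ε))⁻¹ * t := hfc.mul continuous_id
    rw [sub_mul, one_mul, sub_eq_zero, h1, hF, hG,
      ← cfc_mul _ _ T hfc'.continuousOn hfc.continuousOn,
      ← cfc_mul _ _ T (by exact (hfc'.mul hfc).continuousOn) hgc.continuousOn]
    congr 1
    ext t
    rcases le_total t ε with h | h
    · simp [h]
    · have h2 : 0 < t := hε0.trans_le h
      have h3 := Real.mul_self_sqrt h2.le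
      have h4 := (Real.sqrt_pos.2 h2).ne'
      rw [max_eq_left h]
      field_simp
      rw [sq, h3]
  obtain ⟨E, hE, hEG, hann⟩ := hA.exists_range_projection G
  have hEE := hE.isIdempotentElem.eq
  have hEs := hE.isSelfAdjoint.star_eq
  have hEX : E * X = 0 := by
    have h1 : star X * E = 0 := hann _ (by simpa [hGs] using congr(star $hGX))
    simpa [hEs] using congr(star $h1)
  have hFTFE : F * T * F * E = E := by
    have := hann _ hFTF
    rwa [sub_mul, one_mul, sub_eq_zero] at this
  have hVV : star (X * (F * E)) * (X * (F * E)) = E := by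
    calc star (X * (F * E)) * (X * (F * E)) = E * (F * T * F * E) := by
          simp only [star_mul, hEs, hFs, hT, mul_assoc]
      _ = E := by rw [hFTFE, hEE]
  refine ⟨F * E, fun h ↦ ?_, ?_, ?_⟩
  · rw [h, mul_zero] at hVV
    rw [← hVV, zero_mul] at hEG
    exact hG0 hEG.symm
  · rw [hVV, mul_assoc, mul_assoc, hEE]
  · rw [mul_assoc, mul_assoc F, ← mul_assoc E, hEX, zero_mul, mul_zero, mul_zero]

/-- A self-adjoint element `T` with `‖T‖ ≤ r` is within `r / 2` of `r / 2` times a symmetry. -/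
theorem IsBaerStarRing.exists_norm_sub_le (hA : IsBaerStarRing A) {T : A}
    (hT : IsSelfAdjoint T) {r : ℝ} (hr : ‖T‖ ≤ r) :
    ∃ E, IsStarProjection E ∧ ‖T - (r / 2) • (2 * E - 1)‖ ≤ r / 2 := by
  have hr0 : 0 ≤ r := (norm_nonneg T).trans hr
  set P := cfc (fun t : ℝ ↦ max t 0) T with hP
  have hPs : IsSelfAdjoint P := cfc_predicate _ T
  obtain ⟨E, hE, hEP, hann⟩ := hA.exists_range_projection P
  have hTP : (T - P) * P = 0 := by
    have h1 : T - P = cfc (fun t : ℝ ↦ t - max t 0) T := by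
      rw [cfc_sub .., cfc_id' ℝ T]
    rw [h1, hP, ← cfc_mul .., ← cfc_zero (R := ℝ) (a := T)]
    congr 1
    ext t
    rcases le_total t 0 with h | h <;> simp [h]
  have hET : E * T = P := by
    have h1 : (T - P) * E = 0 := hann _ hTP
    have h2 : E * (T - P) = 0 := by
      simpa [hE.isSelfAdjoint.star_eq, hT.star_eq, hPs.star_eq] using congr(star $h1)
    rw [← hEP, ← sub_eq_zero, ← mul_sub, h2]
  -- The symmetry 2E - 1 is the sign of T, and | |t| - r/2 | ≤ r/2 when |t| ≤ r.
  have habs : (2 * E - 1) * T = cfc (fun t : ℝ ↦ |t|) T := by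
    have h1 : (2 * E - 1) * T = (2 : ℝ) • P - T := by
      rw [sub_mul, mul_assoc, hET, one_mul, two_mul, two_smul]
    have h2 : (2 : ℝ) • P - T = cfc (fun t : ℝ ↦ 2 * max t 0 - t) T := by
      rw [cfc_sub .., cfc_const_mul .., cfc_id' ℝ T]
    rw [h1, h2]
    congr 1
    ext t
    rcases le_total t 0 with h | h
    · simp [h, abs_of_nonpos]
    · simp [h, abs_of_nonneg]; ring
  have hs2 : (2 * E - 1) * (2 * E - 1) = 1 := by
    calc (2 * E - 1) * (2 * E - 1) = 4 * (E * E) - 4 * E + 1 := by noncomm_ring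
      _ = 1 := by rw [hE.isIdempotentElem.eq]; simp
  have hss : star (2 * E - 1) = 2 * E - 1 := by
    simp [two_mul, hE.isSelfAdjoint.star_eq]
  have hu : 2 * E - 1 ∈ unitary A := by
    rw [Unitary.mem_iff, hss]
    exact ⟨hs2, hs2⟩
  refine ⟨E, hE, ?_⟩
  rw [← CStarRing.norm_mem_unitary_mul (T - _) hu, mul_sub, habs, mul_smul_comm, hs2,
    ← Algebra.algebraMap_eq_smul_one, ← cfc_const (r / 2) T, ← cfc_sub ..]
  refine norm_cfc_le (by positivity) fun x hx ↦ ?_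
  have h1 : |x| ≤ r := by
    have : Nontrivial A := ⟨1, 0, fun h ↦ by
      have := subsingleton_of_zero_eq_one h.symm
      simp [spectrum.of_subsingleton] at hx⟩
    simpa using (spectrum.norm_le_norm_of_mem hx).trans hr
  rw [Real.norm_eq_abs, abs_le]
  constructor <;> linarith [abs_nonneg x]

/-- Subtracting a multiple of a symmetry leaves the commutator with Y unchanged but halves the norm
bound on T; iterating forces the commutator to vanish. -/
theorem IsBaerStarRing.commute_of_forall_projection (hA : IsBaerStarRing A) {Y : A}
    (hY : ∀ E : A, IsStarProjection E → Commute E Y) (T : A) : Commute T Y := by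
  have key (n : ℕ) : ∀ (T : A), IsSelfAdjoint T → ∀ r, ‖T‖ ≤ r →
      ‖T * Y - Y * T‖ ≤ 2 * r * ‖Y‖ / 2 ^ n := by
    induction n with
    | zero =>
      intro T hT r hr
      calc ‖T * Y - Y * T‖ ≤ ‖T‖ * ‖Y‖ + ‖Y‖ * ‖T‖ :=
            (norm_sub_le _ _).trans (add_le_add (norm_mul_le _ _) (norm_mul_le _ _))
        _ = 2 * ‖T‖ * ‖Y‖ := by ring
        _ ≤ 2 * r * ‖Y‖ / 2 ^ 0 := by
            rw [pow_zero, div_one]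
            gcongr
    | succ n ih =>
      intro T hT r hr
      obtain ⟨E, hE, h⟩ := hA.exists_norm_sub_le hT hr
      have hs : IsSelfAdjoint ((r / 2) • (2 * E - 1)) := by
        refine (IsSelfAdjoint.all _).smul ?_
        simp [IsSelfAdjoint, two_mul, hE.isSelfAdjoint.star_eq]
      have hc : Commute ((r / 2) • (2 * E - 1)) Y := by
        refine Commute.smul_left ?_ _
        rw [two_mul]
        exact ((hY E hE).add_left (hY E hE)).sub_left (Commute.one_left _)
      have h1 := ih _ (hT.sub hs) _ h
      rw [sub_mul, mul_sub, hc.eq, sub_sub_sub_cancel_right] at h1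
      refine h1.trans_eq ?_
      rw [pow_succ]
      field_simp
  have hsa (T : A) (hT : IsSelfAdjoint T) : Commute T Y := by
    have h0 : ‖T * Y - Y * T‖ ≤ 0 := by
      refine ge_of_tendsto' (f := fun n : ℕ ↦ 2 * ‖T‖ * ‖Y‖ / 2 ^ n) (x := Filter.atTop) ?_
        fun n ↦ key n T hT _ le_rfl
      simpa [div_eq_mul_inv] using (tendsto_pow_atTop_nhds_zero_of_lt_one (r := (2⁻¹ : ℝ))
        (by norm_num) (by norm_num)).const_mul (2 * ‖T‖ * ‖Y‖)
    exact sub_eq_zero.1 (norm_le_zero_iff.1 h0)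
  rw [← realPart_add_I_smul_imaginaryPart T]
  exact (hsa _ (realPart T).2).add_left ((hsa _ (imaginaryPart T).2).smul_left _)

/-- If `Z A` has no nonzero elements of square zero, then it is central. -/
theorem IsBaerStarRing.commute_of_forall_mul_self_eq_zero (hA : IsBaerStarRing A) {Z : A}
    (hZc : Z ∈ Set.center A) (hZ : Z * Z = Z) (h : ∀ X, Z * X = X → X * X = 0 → X = 0) (S T : A) :
    Commute T (Z * S) := by
  have hc (B : A) : Z * B = B * Z := (Semigroup.mem_center_iff.1 hZc B).symm
  have hcl (B C : A) : B * (Z * C) = Z * (B * C) := by rw [← mul_assoc, ← hc, mul_assoc]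
  have hproj (E : A) (hE : IsStarProjection E) : E * (Z * S) = E * (Z * S) * E := by
    -- The off-diagonal corner has square zero.
    have h1 := h (E * (Z * S) * (1 - E)) (by
      rw [hcl, ← mul_assoc, ← mul_assoc, hZ]) (by
      calc E * (Z * S) * (1 - E) * (E * (Z * S) * (1 - E))
          = E * (Z * S) * ((1 - E) * E) * (Z * S) * (1 - E) := by simp only [mul_assoc]
        _ = 0 := by rw [hE.one_sub_mul_self]; simp)
    rwa [mul_sub, mul_one, sub_eq_zero] at h1
  refine hA.commute_of_forall_projection (fun E hE ↦ ?_) T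
  have h1 := hproj E hE
  have h2 := hproj (1 - E) hE.one_sub
  have h3 : Z * S * E = E * (Z * S) * E := by
    rw [sub_mul, one_mul, mul_sub, mul_one, sub_mul, ← sub_eq_zero] at h2
    rw [← sub_eq_zero, ← h2]
    abel
  exact h1.trans h3.symm

/-- If no nonzero central summand is commutative, the square-zero partial isometries have
trivial common right annihilator. -/
theorem IsBaerStarRing.eq_zero_of_forall_mul_eq_zero (hA : IsBaerStarRing A)
    (hab : ∀ Z : A, IsStarProjection Z → Z ∈ Set.center A →
      (∀ S T : A, Commute (Z * S * Z) (Z * T * Z)) → Z = 0)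
    {D : A} (hD : ∀ V, IsSquareZeroPartialIsometry V → V * D = 0) : D = 0 := by
  obtain ⟨Z, hZ, h⟩ := hA {V | IsSquareZeroPartialIsometry V}
  simp only [Set.mem_ofPred_eq] at h
  have hZZ := hZ.isIdempotentElem.eq
  have hVZ := (h Z).2 hZZ
  -- Unitary conjugation permutes the V, so their common annihilator is invariant under unitaries,
  -- which span A.
  have hu (u : A) (hu : u ∈ unitary A) : Z * (u * Z) = u * Z := by
    refine (h _).1 fun V hV ↦ ?_
    have h1 := hVZ _ (hV.unitary_conj hu)
    calc V * (u * Z) = u * (star u * V * u * Z) := by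
          simp only [← mul_assoc, Unitary.mul_star_self_of_mem hu, one_mul]
      _ = 0 := by rw [h1, mul_zero]
  have hB (B : A) : Z * (B * Z) = B * Z := by
    have hBmem : B ∈ Submodule.span ℂ (unitary A : Set A) := by
      rw [CStarAlgebra.span_unitary]; trivial
    induction hBmem using Submodule.span_induction with
    | mem u h => exact hu u h
    | zero => simp
    | add x y _ _ hx hy => rw [add_mul, mul_add, hx, hy]
    | smul c x _ hx => rw [smul_mul_assoc, mul_smul_comm, hx]
  have hZc : Z ∈ Set.center A := by
    rw [Semigroup.mem_center_iff]
    intro B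
    have h1 := congr(star $(hB (star B)))
    simp only [star_mul, star_star, hZ.isSelfAdjoint.star_eq] at h1
    rw [← hB, ← mul_assoc, h1]
  have hZ0 : Z = 0 := by
    refine hab Z hZ hZc fun S T ↦ ?_
    have hc : ∀ S T : A, Commute T (Z * S) :=
      hA.commute_of_forall_mul_self_eq_zero hZc hZZ fun X hX hXX ↦ by
        by_contra hX0
        obtain ⟨W, hW, hV⟩ := hA.exists_isSquareZeroPartialIsometry hX0 hXX
        apply hW
        have h1 := hVZ _ hV
        rwa [Semigroup.mem_center_iff.1 hZc, ← mul_assoc, hX] at h1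
    rw [mul_assoc Z T]
    exact hc _ _
  rw [← (h D).1 hD, hZ0, zero_mul]

theorem IsBaerStarRing.map_eq_mul_map_one (hA : IsBaerStarRing A)
    (hab : ∀ Z : A, IsStarProjection Z → Z ∈ Set.center A →
      (∀ S T : A, Commute (Z * S * Z) (Z * T * Z)) → Z = 0)
    {Φ : A → A} (hΦ : ∀ P, IsStarProjection P → P ∈ leftHomogenizer Φ) (X : A) :
    Φ X = X * Φ 1 :=
  sub_eq_zero.1 <| hA.eq_zero_of_forall_mul_eq_zero hab fun _ hV ↦ hV.mul_map_sub_eq_zero hΦ X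

end

/-! ### Von Neumann algebras and the map Φ -/

namespace VonNeumannAlgebra

variable {H : Type*} [NormedAddCommGroup H] [InnerProductSpace ℂ H] [CompleteSpace H]

instance : SMulMemClass (VonNeumannAlgebra H) ℂ (H →L[ℂ] H) where
  smul_mem {M} c _ hx := M.toStarSubalgebra.smul_mem hx c

theorem isClosed (M : VonNeumannAlgebra H) : IsClosed (M : Set (H →L[ℂ] H)) := by
  rw [← M.centralizer_centralizer]
  exact Set.isClosed_centralizer _

noncomputable instance (M : VonNeumannAlgebra H) : CStarAlgebra M :=
  have : IsClosed (M : Set (H →L[ℂ] H)) := M.isClosed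
  StarSubalgebra.cstarAlgebra M

/-- The common kernel of S is invariant under the commutant, so its projection lies in M. -/
theorem isBaerStarRing (M : VonNeumannAlgebra H) : IsBaerStarRing M := by
  intro S
  let W : Submodule ℂ H := ⨅ V ∈ S, (V : H →L[ℂ] H).ker
  have hmem (x : H) : x ∈ W ↔ ∀ V ∈ S, (V : H →L[ℂ] H) x = 0 := by
    simp [W, Submodule.mem_iInf]
  have hWc : IsClosed (W : Set H) := by
    have : (W : Set H) = ⋂ V ∈ S, {x | (V : H →L[ℂ] H) x = 0} := by
      ext x
      simp [hmem]
    rw [this]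
    exact isClosed_biInter fun V _ ↦ isClosed_eq (V : H →L[ℂ] H).continuous continuous_const
  have : CompleteSpace W := hWc.completeSpace_coe
  have hZM : W.starProjection ∈ M := by
    rw [IsStarProjection.mem_iff isStarProjection_starProjection]
    intro y hy
    rw [W.range_starProjection, Module.End.mem_invtSubmodule_iff_forall_mem_of_mem]
    intro x hx
    rw [hmem] at hx ⊢
    intro V hV
    have h1 := congr($(mem_commutant_iff.1 hy V V.2) x)
    simp only [mul_apply_eq_comp, hx V hV, map_zero] at h1
    exact h1
  refine ⟨⟨W.starProjection, hZM⟩, ?_, fun D ↦ ?_⟩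
  · have h : IsStarProjection W.starProjection := isStarProjection_starProjection
    exact ⟨Subtype.ext h.isIdempotentElem, Subtype.ext h.isSelfAdjoint⟩
  · have h1 : (⟨W.starProjection, hZM⟩ : M) * D = D ↔ ∀ x, (D : H →L[ℂ] H) x ∈ W := by
      simp [Subtype.ext_iff, ContinuousLinearMap.ext_iff, Submodule.starProjection_eq_self_iff]
    have h2 (V : M) : V * D = 0 ↔ ∀ x, (V : H →L[ℂ] H) ((D : H →L[ℂ] H) x) = 0 := by
      simp [Subtype.ext_iff, ContinuousLinearMap.ext_iff]
    simp only [h1, h2, hmem]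
    exact ⟨fun h x V hV ↦ h V hV x, fun h V hV x ↦ h x V hV⟩

theorem mul_eq_self_of_rangeProjection_le {A B E : H →L[ℂ] H} (hA : E * A = A)
    (h : rangeProjection B ≤ rangeProjection A) : E * B = B := by
  have h1 : B.range.topologicalClosure ≤ A.range.topologicalClosure := by
    rwa [rangeProjection, rangeProjection, Submodule.starProjection_le_starProjection_iff] at h
  have h2 : IsClosed {x | E x = x} := isClosed_eq E.continuous continuous_id
  have h3 : (A.range.topologicalClosure : Set H) ⊆ {x | E x = x} := by
    rw [Submodule.topologicalClosure_coe]
    refine closure_minimal ?_ h2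
    rintro _ ⟨x, rfl⟩
    exact congr($hA x)
  ext x
  exact h3 (h1 (B.range.le_topologicalClosure ⟨x, rfl⟩))

/-- PX and (1 - P)X are orthogonal, and range-contractivity keeps their images under P and 1 - P
respectively. -/
theorem IsOrthoAdditive.mem_leftHomogenizer {M : VonNeumannAlgebra H} {Φ : M → M}
    (hadd : M.IsOrthoAdditive Φ) (hrange : M.IsRangeContractive Φ) {P : M}
    (hP : IsStarProjection P) : P ∈ leftHomogenizer Φ := by
  intro X
  have hfix {E : M} (hE : IsStarProjection E) (Y : M) : E * Φ (E * Y) = Φ (E * Y) := by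
    refine Subtype.ext (mul_eq_self_of_rangeProjection_le ?_ (hrange (E * Y)))
    rw [← MulMemClass.coe_mul, ← mul_assoc, hE.isIdempotentElem.eq]
  have h := hadd (P * X) ((1 - P) * X) (by
    rw [Orthogonal, star_mul, hP.isSelfAdjoint.star_eq, mul_assoc, ← mul_assoc P,
      hP.mul_one_sub_self, zero_mul, mul_zero])
  rw [← add_mul, add_sub_cancel, one_mul] at h
  rw [h, mul_add, hfix hP, ← hfix hP.one_sub, ← mul_assoc, hP.mul_one_sub_self, zero_mul, add_zero]

end VonNeumannAlgebra

theorem theorem1p1 {H : Type*} [NormedAddCommGroup H] [InnerProductSpace ℂ H] [CompleteSpace H]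
    (M : VonNeumannAlgebra H) (hM : ¬ M.HasTypeIOneSummand)
    (Φ : M → M) (hadd : M.IsOrthoAdditive Φ) (hrange : M.IsRangeContractive Φ) :
    ∀ A : M, Φ A = A * Φ 1 :=
  M.isBaerStarRing.map_eq_mul_map_one
    (fun Z hZ hZc hZab ↦ by_contra fun hZ0 ↦ hM ⟨Z, hZ0, hZc, hZ, hZab⟩)
    (fun _ hP ↦ hadd.mem_leftHomogenizer hrange hP)
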